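/- Let $k$ be a field of characteristic zero, $n\ge 3$, $k[\mathbf x]=k[x_1,\dots,x_n]$, let $\Gamma$ be a finitely generated totally ordered $\mathbb Z$-module, and let $\mathbf w=(w_1,\dots,w_n)\in\Gamma^n$ with $w_i>0$ for all $i$. For $f\in k[\mathbf x]\setminus\{0\}$ let $\deg f\in\Gamma$ be the $\mathbf w$-weighted degree of $f$ (where $x_1^{a_1}\cdots x_n^{a_n}$ has degree $\sum_i a_iw_i$), let $f^{\mathbf w}$ be the $\mathbf w$-homogeneous component of $f$ of degree $\deg f$, and set $\deg 0=-\infty$. For a differential form $\omega=\sum_{i<j}f_{i,j}\,dx_i\wedge dx_j\in\bigwedge^2\Omega_{k[\mathbf x]/k}$ let $\deg\omega=\max_{i<j}\deg(f_{i,j}x_ix_j)$. For $h_1,h_2\in k[\mathbf x]\setminus\{0\}$ write $h_1\approx h_2$ if $h_1,h_2$ are linearly dependent over $k$. Let $\mathcal T$ be the set of triples of elements of $k[\mathbf x]$ that are algebraically independent over $k$. For $F=(f_1,f_2,f_3)$ and $G=(g_1,g_2,g_3)$ in $\mathcal T$, the pair $(F,G)$ satisfies the Shestakov–Umirbaev condition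 if: (SU1) $g_1=f_1+af_3^2+cf_3$ and $g_2=f_2+bf_3$ for some $a,b,c\in k$, and $g_3-f_3\in k[g_1,g_2]$; (SU2) $\deg f_1\le\deg g_1$ and $\deg f_2=\deg g_2$; (SU3) $(g_1^{\mathbf w})^2\approx(g_2^{\mathbf w})^s$ for some odd number $s\ge3$; (SU4) $\deg f_3\le\deg g_1$ and $f_3^{\mathbf w}\notin k[g_1^{\mathbf w},g_2^{\mathbf w}]$; (SU5) $\deg g_3<\deg f_3$; (SU6) $\deg g_3<\deg g_1-\deg g_2+\deg(dg_1\wedge dg_2)$. **Proposition.** Let $F,G^1,G^2\in\mathcal T$, where $G^j=(g_1^j,g_2^j,g_3^j)$ for $j=1,2$. If $(F,G^1)$ and $(F,G^2)$ both satisfy the Shestakov–Umirbaev condition, then $g_1^1=g_1^2$, $g_2^1=g_2^2$, and $g_3^1-g_3^2\in k[g_2^1]$. -/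

import Mathlib

open MvPolynomial

namespace ShestakovUmirbaev

noncomputable section

/-- The `w`-degree of a polynomial, with values in `Γ ∪ {-∞}`; it is `⊥ = -∞` exactly at `0`. -/
abbrev wdeg {k Γ : Type*} [Field k] [AddCommGroup Γ] [LinearOrder Γ] {n : ℕ}
    (w : Fin n → Γ) (f : MvPolynomial (Fin n) k) : WithBot Γ :=
  weightedTotalDegree' w f

/-- The leading form `f^w` of `f`: the `w`-homogeneous component of `f` in degree `deg_w f`
(with the convention that the leading form of `0` is `0`). -/
def leadingForm {k Γ : Type*} [Field k] [AddCommGroup Γ] [LinearOrder Γ] {n : ℕ}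
    (w : Fin n → Γ) (f : MvPolynomial (Fin n) k) : MvPolynomial (Fin n) k :=
  weightedHomogeneousComponent w ((wdeg w f).unbotD 0) f

/-- The `w`-degree of a differential `l`-form `ω = ∑_{i₁ < ⋯ < i_l} f_{i₁…i_l} dx_{i₁} ∧ ⋯ ∧ dx_{i_l}`:
the maximum of `deg_w (f_{i₁…i_l} x_{i₁} ⋯ x_{i_l})`. The coefficients are the coordinates of `ω`
in the basis of the exterior power induced by the basis `dx₁, …, dxₙ` of the module of
differentials; the index `s` runs over the `l`-element subsets of the index set. -/
def formDeg {k Γ : Type*} [Field k] [AddCommGroup Γ] [LinearOrder Γ] {n : ℕ}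
    (w : Fin n → Γ) {l : ℕ}
    (ω : ⋀[MvPolynomial (Fin n) k]^l (Ω[MvPolynomial (Fin n) k⁄k])) : WithBot Γ :=
  (Finset.univ : Finset (Set.powersetCard (Fin n) l)).sup fun s =>
    wdeg w ((((KaehlerDifferential.mvPolynomialBasis k (Fin n)).exteriorPower l).repr ω s) *
      ∏ i ∈ (s : Finset (Fin n)), X i)

/-- The `2`-form `df ∧ dg`. -/
def dWedge {k : Type*} [Field k] {n : ℕ} (f g : MvPolynomial (Fin n) k) :
    ⋀[MvPolynomial (Fin n) k]^2 (Ω[MvPolynomial (Fin n) k⁄k]) :=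
  exteriorPower.ιMulti (MvPolynomial (Fin n) k) 2
    ![KaehlerDifferential.D k (MvPolynomial (Fin n) k) f,
      KaehlerDifferential.D k (MvPolynomial (Fin n) k) g]

/-- The set of triples of polynomials that are algebraically independent over `k`. -/
def Triples (k : Type*) [Field k] (n : ℕ) : Set (Fin 3 → MvPolynomial (Fin n) k) :=
  {F | AlgebraicIndependent k F}

/-- `h₁ ≈ h₂`: linear dependence over `k` (used for nonzero polynomials). -/
def Approx {k : Type*} [Field k] {n : ℕ} (h₁ h₂ : MvPolynomial (Fin n) k) : Prop :=
  ¬ LinearIndependent k ![h₁, h₂]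

/-- The Shestakov-Umirbaev condition for the pair `(F, G)` and the weight `w`. The triples are
indexed by `Fin 3`, so that `f₁, f₂, f₃` are `F 0, F 1, F 2`, and likewise for `G`. -/
structure SUCondition {k Γ : Type*} [Field k] [AddCommGroup Γ] [LinearOrder Γ] {n : ℕ}
    (w : Fin n → Γ) (F G : Fin 3 → MvPolynomial (Fin n) k) : Prop where
  su1 : (∃ a b c : k, G 0 = F 0 + C a * F 2 ^ 2 + C c * F 2 ∧ G 1 = F 1 + C b * F 2) ∧
    G 2 - F 2 ∈ Algebra.adjoin k {G 0, G 1}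
  su2 : wdeg w (F 0) ≤ wdeg w (G 0) ∧ wdeg w (F 1) = wdeg w (G 1)
  su3 : ∃ s : ℕ, Odd s ∧ 3 ≤ s ∧ Approx (leadingForm w (G 0) ^ 2) (leadingForm w (G 1) ^ s)
  su4 : wdeg w (F 2) ≤ wdeg w (G 0) ∧
    leadingForm w (F 2) ∉ Algebra.adjoin k {leadingForm w (G 0), leadingForm w (G 1)}
  su5 : wdeg w (G 2) < wdeg w (F 2)
  /-- `deg g₃ < deg g₁ - deg g₂ + deg (dg₁ ∧ dg₂)`, with the (finite) degree of `g₂ ≠ 0` moved to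
  the left-hand side because `Γ ∪ {-∞}` has no subtraction. -/
  su6 : wdeg w (G 2) + wdeg w (G 1) < wdeg w (G 0) + formDeg w (dWedge (G 0) (G 1))

end

end ShestakovUmirbaev

/-! Write `g₁, g₂, g₃` for an admissible `G`, `f₃` for `F 2`, and set `d₁ = deg g₁`, `d₂ = deg g₂`,
`D = deg (dg₁ ∧ dg₂)`, `t = deg f₃`.

The engine is a Shestakov-Umirbaev inequality, `PairData.exists_virtual`. For a polynomial `Φ(x,
y)`, let `v` be its weighted degree when `x, y` have degrees `d₁, d₂`. Its top part, with `y`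
replaced by the leading form of `g₂`, is a one-variable polynomial `T(x)`; let `m` be the
multiplicity of the leading form of `g₁` as a root of `T`. The degree of `Φ(g₁, g₂)` is below `v`
only if `m > 0`. After `m` derivatives in `x` the cancellation is gone, and the identity `d(Φ(g₁,
g₂)) ∧ dg₂ = Φ_x(g₁, g₂) dg₁ ∧ dg₂` bounds the loss at each derivative. Since `2 d₁ = s d₂` with `s`
odd, `T(-x) = ± T(x)`, so `2m ≤ deg T` and `2m d₁ ≤ v`. Hence `deg Φ(g₁, g₂) ≥ m (d₁ - d₂ + D)`.

Applied to `f₃ - g₃ = Φ(g₁, g₂)`, condition (SU4) forces `m ≥ 1`. `SUCondition.estimates` deduces `t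
≥ d₁ - d₂ + D` and `deg (df₃ ∧ dg₂) ≥ d₁ + D`; if `t ≤ d₂`, it also gives `2 d₁ = 3 d₂` and the
exact degree `2 d₂ + D` of `df₃ ∧ dg₁`.

Two admissible pairs over the same `F` differ by `g₁' = g₁ + a f₃² + c f₃`, `g₂' = g₂ + b f₃`. In
`perturb_eq_zero`, `dg₁' ∧ dg₂'` is expanded: if one of `a, b, c` is nonzero, a single term
dominates and makes `D'` too large for the estimates belonging to the second pair. So `g₁, g₂` are
unique. The difference of the two third entries then lies in `k[g₁, g₂]` with degree below both `d₁`
and `d₁ - d₂ + D`; the same inequality gives `m = 0`, so `x` does not occur in `Φ`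
(`PairData.mem_adjoin_singleton`). -/

namespace ShestakovUmirbaev

/-! ### Weighted degree of polynomials: a valuation with multiplicative top components. -/

section WeightedDegree

variable {k Γ : Type*} [Field k] [AddCommGroup Γ] [LinearOrder Γ] {n : ℕ} {w : Fin n → Γ}
  {f g : MvPolynomial (Fin n) k} {a b : Γ}

lemma wdeg_le_iff {α : WithBot Γ} :
    wdeg w f ≤ α ↔ ∀ d, coeff d f ≠ 0 → (Finsupp.weight w d : WithBot Γ) ≤ α := by
  simp [wdeg, weightedTotalDegree', Finset.sup_le_iff]

lemma wdeg_lt_coe_iff : wdeg w f < a ↔ ∀ d, coeff d f ≠ 0 → Finsupp.weight w d < a := by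
  simp [wdeg, weightedTotalDegree', Finset.sup_lt_iff (WithBot.bot_lt_coe a)]

lemma wdeg_eq_bot_iff : wdeg w f = ⊥ ↔ f = 0 := weightedTotalDegree'_eq_bot_iff w f

@[simp]
lemma wdeg_zero : wdeg w (0 : MvPolynomial (Fin n) k) = ⊥ := weightedTotalDegree'_zero w

lemma exists_wdeg_eq_coe (hf : f ≠ 0) : ∃ a : Γ, wdeg w f = a :=
  let ⟨a, ha⟩ := WithBot.ne_bot_iff_exists.1 (mt wdeg_eq_bot_iff.1 hf)
  ⟨a, ha.symm⟩

lemma ne_zero_of_wdeg_eq_coe (h : wdeg w f = a) : f ≠ 0 := by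
  rintro rfl
  simp at h

lemma wdeg_add_le {α : WithBot Γ} (hf : wdeg w f ≤ α) (hg : wdeg w g ≤ α) :
    wdeg w (f + g) ≤ α := by
  rw [wdeg_le_iff] at *
  intro d hd
  by_cases h : coeff d f = 0
  · exact hg d fun h' => hd (by simp [h, h'])
  · exact hf d h

lemma wdeg_neg : wdeg w (-f) = wdeg w f := by
  simp [wdeg, weightedTotalDegree', support_neg]

lemma wdeg_sub_le {α : WithBot Γ} (hf : wdeg w f ≤ α) (hg : wdeg w g ≤ α) :
    wdeg w (f - g) ≤ α := by
  rw [sub_eq_add_neg]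
  exact wdeg_add_le hf (wdeg_neg.trans_le hg)

lemma wdeg_sum_le {ι : Type*} (s : Finset ι) (F : ι → MvPolynomial (Fin n) k) {α : WithBot Γ}
    (h : ∀ i ∈ s, wdeg w (F i) ≤ α) : wdeg w (∑ i ∈ s, F i) ≤ α :=
  Finset.sum_induction F (fun x => wdeg w x ≤ α) (fun _ _ => wdeg_add_le) (by simp) h

/-- Adding a polynomial of strictly smaller degree does not change the degree. -/
lemma wdeg_add_eq_left (h : wdeg w g < wdeg w f) : wdeg w (f + g) = wdeg w f := by
  refine le_antisymm (wdeg_add_le le_rfl h.le) ?_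
  by_contra! h'
  have : wdeg w f ≤ max (wdeg w (f + g)) (wdeg w g) := by
    simpa using wdeg_sub_le (f := f + g) (g := g) (α := max (wdeg w (f + g)) (wdeg w g))
      (le_max_left _ _) (le_max_right _ _)
  exact absurd (max_lt h' h) this.not_gt

lemma wdeg_C_le (c : k) : wdeg w (C c) ≤ 0 := by
  classical
  rw [wdeg_le_iff]
  intro d hd
  obtain rfl : 0 = d := by
    by_contra h
    simp [coeff_C, h] at hd
  simp

lemma wdeg_C {c : k} (hc : c ≠ 0) : wdeg w (C c) = 0 := by
  classical
  rw [wdeg, weightedTotalDegree', C_apply, support_monomial, if_neg hc]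
  simp

lemma component_eq_zero (h : wdeg w f < a) : weightedHomogeneousComponent w a f = 0 := by
  apply weightedHomogeneousComponent_eq_zero'
  intro d hd
  exact (wdeg_lt_coe_iff.1 h d (by simpa using hd)).ne

lemma component_ne_zero_of_wdeg_eq (h : wdeg w f = a) :
    weightedHomogeneousComponent w a f ≠ 0 := by
  classical
  intro h0
  have h1 : wdeg w f < a := by
    rw [wdeg_lt_coe_iff]
    intro d hd
    have h2 := wdeg_le_iff.1 h.le d hd
    refine lt_of_le_of_ne (by exact_mod_cast h2) fun h3 => hd ?_
    have := congrArg (coeff d) h0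
    simpa [coeff_weightedHomogeneousComponent, h3] using this
  exact h1.ne h

lemma le_wdeg_of_component_ne_zero (h : weightedHomogeneousComponent w a f ≠ 0) :
    (a : WithBot Γ) ≤ wdeg w f := by
  by_contra! h'
  exact h (component_eq_zero h')

lemma leadingForm_eq (h : wdeg w f = a) :
    leadingForm w f = weightedHomogeneousComponent w a f := by
  simp [leadingForm, h]

lemma wdeg_leadingForm (hf : wdeg w f = a) : wdeg w (leadingForm w f) = a := by
  classical
  rw [leadingForm_eq hf]
  refine le_antisymm ?_ (le_wdeg_of_component_ne_zero ?_)
  · rw [wdeg_le_iff]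
    intro d hd
    rw [coeff_weightedHomogeneousComponent] at hd
    exact_mod_cast (ite_ne_right_iff.1 hd).1.le
  · rw [(weightedHomogeneousComponent_isWeightedHomogeneous a f).weightedHomogeneousComponent_same]
    exact component_ne_zero_of_wdeg_eq hf

/-- The Euler operator `X i * pderiv i` acts diagonally on monomials, so it creates no new
exponents. -/
lemma wdeg_X_mul_pderiv_le (i : Fin n) : wdeg w (X i * pderiv i f) ≤ wdeg w f := by
  rw [wdeg_le_iff]
  intro d hd
  refine wdeg_le_iff.1 le_rfl d fun h => hd ?_
  rw [coeff_X_mul']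
  split_ifs with hi
  · rw [coeff_pderiv, tsub_add_cancel_of_le, h, zero_mul]
    rw [Finsupp.single_le_iff]
    exact Nat.one_le_iff_ne_zero.2 (Finsupp.mem_support_iff.1 hi)
  · rfl

lemma wdeg_X (i : Fin n) : wdeg w (X i : MvPolynomial (Fin n) k) = w i := by
  simp [wdeg, weightedTotalDegree', support_X, Finsupp.weight_single]

variable [IsOrderedAddMonoid Γ]

lemma wdeg_mul_le_coe (hf : wdeg w f ≤ a) (hg : wdeg w g ≤ b) :
    wdeg w (f * g) ≤ (a + b : Γ) := by
  classical
  rw [wdeg_le_iff] at *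
  intro d hd
  rw [coeff_mul] at hd
  obtain ⟨x, hx, hx'⟩ := Finset.exists_ne_zero_of_sum_ne_zero hd
  rw [Finset.HasAntidiagonal.mem_antidiagonal] at hx
  have h1 := hf x.1 (left_ne_zero_of_mul hx')
  have h2 := hg x.2 (right_ne_zero_of_mul hx')
  rw [← hx, map_add]
  exact_mod_cast add_le_add (WithBot.coe_le_coe.1 h1) (WithBot.coe_le_coe.1 h2)

/-- Top-degree components are multiplicative. -/
lemma component_mul (hf : wdeg w f ≤ a) (hg : wdeg w g ≤ b) :
    weightedHomogeneousComponent w (a + b) (f * g) =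
      weightedHomogeneousComponent w a f * weightedHomogeneousComponent w b g := by
  classical
  rw [wdeg_le_iff] at *
  ext d
  simp only [coeff_weightedHomogeneousComponent, coeff_mul]
  rw [← Finset.sum_filter_of_ne (p := fun x : (Fin n →₀ ℕ) × (Fin n →₀ ℕ) =>
      Finsupp.weight w x.1 = a ∧ Finsupp.weight w x.2 = b)
    (f := fun x => (if Finsupp.weight w x.1 = a then coeff x.1 f else 0) *
      (if Finsupp.weight w x.2 = b then coeff x.2 g else 0))
    (by
      intro x _ hx
      by_contra h
      apply hx
      rw [not_and_or] at h
      rcases h with h | h <;> simp [h])]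
  split_ifs with h
  · rw [Finset.sum_filter]
    refine Finset.sum_congr rfl fun x hx => ?_
    rw [Finset.HasAntidiagonal.mem_antidiagonal] at hx
    split_ifs with h' h1 h2 <;> try simp_all
    by_contra! h3
    have h1 := hf x.1 h3.1
    have h2 := hg x.2 h3.2
    rw [← hx, map_add] at h
    rcases h1.lt_or_eq with h4 | h4
    · exact (add_lt_add_of_lt_of_le h4 h2).ne h
    · refine h' h4 ?_
      rw [h4] at h
      exact add_left_cancel h
  · symm
    apply Finset.sum_eq_zero
    intro x hx
    rw [Finset.mem_filter, Finset.HasAntidiagonal.mem_antidiagonal] at hx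
    exact absurd (by rw [← hx.1, map_add, hx.2.1, hx.2.2]) h

lemma wdeg_mul : wdeg w (f * g) = wdeg w f + wdeg w g := by
  by_cases hf : f = 0
  · simp [hf]
  by_cases hg : g = 0
  · simp [hg]
  obtain ⟨a, ha⟩ := exists_wdeg_eq_coe (w := w) hf
  obtain ⟨b, hb⟩ := exists_wdeg_eq_coe (w := w) hg
  rw [ha, hb, ← WithBot.coe_add]
  refine le_antisymm (wdeg_mul_le_coe ha.le hb.le) (le_wdeg_of_component_ne_zero ?_)
  rw [component_mul ha.le hb.le]
  exact mul_ne_zero (component_ne_zero_of_wdeg_eq ha) (component_ne_zero_of_wdeg_eq hb)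

lemma wdeg_pow_coe (hf : wdeg w f = a) (m : ℕ) : wdeg w (f ^ m) = (m • a : Γ) := by
  induction m with
  | zero => simpa using wdeg_C (w := w) (one_ne_zero : (1 : k) ≠ 0)
  | succ m ih => rw [pow_succ, wdeg_mul, ih, hf, succ_nsmul, WithBot.coe_add]

lemma component_pow (hf : wdeg w f = a) (m : ℕ) :
    weightedHomogeneousComponent w (m • a) (f ^ m) = weightedHomogeneousComponent w a f ^ m := by
  induction m with
  | zero => simpa using (isWeightedHomogeneous_one k w).weightedHomogeneousComponent_same
  | succ m ih => rw [pow_succ, succ_nsmul, component_mul (wdeg_pow_coe hf m).le hf.le, ih, pow_succ]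

lemma wdeg_nonneg (hw : ∀ i, 0 < w i) (hf : f ≠ 0) : 0 ≤ wdeg w f := by
  obtain ⟨d, hd⟩ := ne_zero_iff.1 hf
  refine le_trans ?_ (wdeg_le_iff.1 le_rfl d hd)
  rw [Finsupp.weight_apply]
  exact_mod_cast Finset.sum_nonneg fun i _ => nsmul_nonneg (hw i).le _

end WeightedDegree

end ShestakovUmirbaev

namespace ShestakovUmirbaev

/-! ### Degree of differential forms. -/

section FormDegree

variable {k Γ : Type*} [Field k] [AddCommGroup Γ] [LinearOrder Γ] {n : ℕ} {w : Fin n → Γ}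
  {f g : MvPolynomial (Fin n) k} {l : ℕ}
  {ω η : ⋀[MvPolynomial (Fin n) k]^l (Ω[MvPolynomial (Fin n) k⁄k])}

lemma formDeg_le_iff {α : WithBot Γ} : formDeg w ω ≤ α ↔ ∀ s : Set.powersetCard (Fin n) l,
    wdeg w ((((KaehlerDifferential.mvPolynomialBasis k (Fin n)).exteriorPower l).repr ω s) *
      ∏ i ∈ (s : Finset (Fin n)), X i) ≤ α := by
  simp [formDeg, Finset.sup_le_iff]

@[simp]
lemma formDeg_zero :
    formDeg w (0 : ⋀[MvPolynomial (Fin n) k]^l (Ω[MvPolynomial (Fin n) k⁄k])) = ⊥ := by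
  rw [← le_bot_iff, formDeg_le_iff]
  simp

lemma formDeg_add_le {α : WithBot Γ} (hω : formDeg w ω ≤ α) (hη : formDeg w η ≤ α) :
    formDeg w (ω + η) ≤ α := by
  rw [formDeg_le_iff] at *
  intro s
  rw [map_add, Finsupp.add_apply, add_mul]
  exact wdeg_add_le (hω s) (hη s)

lemma formDeg_neg : formDeg w (-ω) = formDeg w ω := by
  simp only [formDeg, map_neg, Finsupp.neg_apply, neg_mul, wdeg_neg]

lemma formDeg_sub_le {α : WithBot Γ} (hω : formDeg w ω ≤ α) (hη : formDeg w η ≤ α) :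
    formDeg w (ω - η) ≤ α := by
  rw [sub_eq_add_neg]
  exact formDeg_add_le hω (formDeg_neg.trans_le hη)

/-- Adding a form of strictly smaller degree does not change the degree. -/
lemma formDeg_add_eq_left (h : formDeg w η < formDeg w ω) :
    formDeg w (ω + η) = formDeg w ω := by
  refine le_antisymm (formDeg_add_le le_rfl h.le) ?_
  by_contra! h'
  have : formDeg w ω ≤ max (formDeg w (ω + η)) (formDeg w η) := by
    simpa using formDeg_sub_le (ω := ω + η) (η := η) (α := max (formDeg w (ω + η)) (formDeg w η))
      (le_max_left _ _) (le_max_right _ _)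
  exact absurd (max_lt h' h) this.not_gt

lemma formDeg_add_eq_right (h : formDeg w ω < formDeg w η) :
    formDeg w (ω + η) = formDeg w η := by
  rw [add_comm, formDeg_add_eq_left h]

variable [IsOrderedAddMonoid Γ]

lemma formDeg_smul (p : MvPolynomial (Fin n) k) :
    formDeg w (p • ω) = wdeg w p + formDeg w ω := by
  have h : ∀ s : Set.powersetCard (Fin n) l,
      wdeg w ((((KaehlerDifferential.mvPolynomialBasis k (Fin n)).exteriorPower l).repr (p • ω) s) *
      ∏ i ∈ (s : Finset (Fin n)), X i) = wdeg w p +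
      wdeg w ((((KaehlerDifferential.mvPolynomialBasis k (Fin n)).exteriorPower l).repr ω s) *
      ∏ i ∈ (s : Finset (Fin n)), X i) := by
    intro s
    rw [map_smul, Finsupp.smul_apply, smul_eq_mul, mul_assoc, wdeg_mul]
  simp only [formDeg, h]
  refine (Finset.apply_sup_eq_sup_comp_of_linearOrder (wdeg w p + ·) ?_ ?_).symm
  · intro a b hab
    exact add_le_add_right hab _
  · simp

/-- A nonzero coefficient has nonnegative degree, and it is multiplied by at least one variable of
positive weight. -/
lemma formDeg_pos (hw : ∀ i, 0 < w i) (hl : l ≠ 0) (hω : formDeg w ω ≠ ⊥) : 0 < formDeg w ω := by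
  by_contra! h
  apply hω
  rw [← le_bot_iff, formDeg_le_iff]
  intro s
  rw [formDeg_le_iff] at h
  have hs := h s
  rw [le_bot_iff, wdeg_eq_bot_iff]
  by_contra h0
  have h1 : ((KaehlerDifferential.mvPolynomialBasis k (Fin n)).exteriorPower l).repr ω s ≠ 0 :=
    left_ne_zero_of_mul h0
  rw [wdeg_mul] at hs
  have hs' : (s : Finset (Fin n)).Nonempty := by
    rw [← Finset.card_pos, s.2]
    exact Nat.pos_of_ne_zero hl
  have hX : ∀ s : Finset (Fin n),
      wdeg w (∏ i ∈ s, X i : MvPolynomial (Fin n) k) = (∑ i ∈ s, w i : Γ) := by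
    intro s
    induction s using Finset.induction_on with
    | empty => simpa using wdeg_C (w := w) (one_ne_zero : (1 : k) ≠ 0)
    | insert i s hi ih =>
      rw [Finset.prod_insert hi, Finset.sum_insert hi, wdeg_mul, ih, wdeg_X, WithBot.coe_add]
  obtain ⟨a, ha⟩ := exists_wdeg_eq_coe (w := w) h1
  have ha' := wdeg_nonneg hw h1
  rw [ha] at ha' hs
  rw [hX, ← WithBot.coe_add, ← WithBot.coe_zero, WithBot.coe_le_coe] at hs
  have h3 : 0 < ∑ i ∈ (s : Finset (Fin n)), w i := Finset.sum_pos (fun i _ => hw i) hs'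
  exact (add_pos_of_nonneg_of_pos (WithBot.coe_nonneg.1 ha') h3).not_ge hs

lemma formDeg_dWedge_le {a b : Γ} (hf : wdeg w f ≤ a) (hg : wdeg w g ≤ b) :
    formDeg w (dWedge f g) ≤ (a + b : Γ) := by
  rw [formDeg_le_iff]
  intro s
  rw [exteriorPower.basis_repr_apply, dWedge, exteriorPower.ιMultiDual_apply_ιMulti,
    Matrix.det_fin_two]
  set e := Set.powersetCard.ofFinEmbEquiv.symm s with he
  have hs : (∏ i ∈ (s : Finset (Fin n)), X i : MvPolynomial (Fin n) k) = X (e 0) * X (e 1) := by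
    have : (s : Finset (Fin n)) = Finset.univ.image e := by
      ext i
      have := Set.powersetCard.mem_range_ofFinEmbEquiv_symm_iff_mem s i
      simp only [Finset.mem_image, Finset.mem_univ, true_and]
      exact this.symm
    rw [this, Finset.prod_image (by intro x _ y _ h; exact e.injective h), Fin.prod_univ_two]
  rw [hs]
  simp only [Matrix.of_apply, Module.Basis.coord_apply, Matrix.cons_val_zero, Matrix.cons_val_one,
    KaehlerDifferential.mvPolynomialBasis_repr_apply]
  -- Sharing the two variables among the factors of the minor turns every partial derivative into an
  -- Euler operator.
  have h1 : (pderiv (e 0) f * pderiv (e 1) g - pderiv (e 1) f * pderiv (e 0) g) *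
      (X (e 0) * X (e 1)) = X (e 0) * pderiv (e 0) f * (X (e 1) * pderiv (e 1) g) -
        X (e 1) * pderiv (e 1) f * (X (e 0) * pderiv (e 0) g) := by
    ring
  rw [h1]
  exact wdeg_sub_le (wdeg_mul_le_coe ((wdeg_X_mul_pderiv_le _).trans hf)
    ((wdeg_X_mul_pderiv_le _).trans hg)) (wdeg_mul_le_coe ((wdeg_X_mul_pderiv_le _).trans hf)
    ((wdeg_X_mul_pderiv_le _).trans hg))

end FormDegree

/-! ### Bilinearity and alternation of the wedge of 1-forms. -/

section Wedge

variable {k : Type*} [Field k] {n : ℕ}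

lemma update_pair_zero {α : Type*} (x y z : α) : Function.update ![x, y] 0 z = ![z, y] := by
  ext i
  fin_cases i <;> simp

lemma update_pair_one {α : Type*} (x y z : α) : Function.update ![x, y] 1 z = ![x, z] := by
  ext i
  fin_cases i <;> simp

/-- The wedge product of two `1`-forms, as a bilinear map. -/
noncomputable def wedge :
    Ω[MvPolynomial (Fin n) k⁄k] →ₗ[MvPolynomial (Fin n) k] Ω[MvPolynomial (Fin n) k⁄k]
      →ₗ[MvPolynomial (Fin n) k] ⋀[MvPolynomial (Fin n) k]^2 (Ω[MvPolynomial (Fin n) k⁄k]) :=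
  LinearMap.mk₂ _ (fun x y => exteriorPower.ιMulti (MvPolynomial (Fin n) k) 2 ![x, y])
    (fun x x' y => by
      simpa only [update_pair_zero] using
        (exteriorPower.ιMulti (MvPolynomial (Fin n) k) 2).map_update_add ![x, y] 0 x x')
    (fun c x y => by
      simpa only [update_pair_zero] using
        (exteriorPower.ιMulti (MvPolynomial (Fin n) k) 2).map_update_smul ![x, y] 0 c x)
    (fun x y y' => by
      simpa only [update_pair_one] using
        (exteriorPower.ιMulti (MvPolynomial (Fin n) k) 2).map_update_add ![x, y] 1 y y')
    (fun c x y => by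
      simpa only [update_pair_one] using
        (exteriorPower.ιMulti (MvPolynomial (Fin n) k) 2).map_update_smul ![x, y] 1 c y)

lemma dWedge_eq_wedge (f g : MvPolynomial (Fin n) k) :
    dWedge f g = wedge (KaehlerDifferential.D k _ f) (KaehlerDifferential.D k _ g) := rfl

@[simp]
lemma wedge_self (x : Ω[MvPolynomial (Fin n) k⁄k]) : wedge x x = 0 :=
  (exteriorPower.ιMulti (MvPolynomial (Fin n) k) 2).map_eq_zero_of_eq ![x, x] (i := 0) (j := 1)
    rfl (by decide)

lemma wedge_swap (x y : Ω[MvPolynomial (Fin n) k⁄k]) : wedge x y = -wedge y x := by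
  have := wedge_self (x + y)
  simp only [map_add, LinearMap.add_apply, wedge_self, zero_add, add_zero] at this
  rw [eq_neg_iff_add_eq_zero, add_comm]
  exact this

end Wedge

end ShestakovUmirbaev

namespace ShestakovUmirbaev

/-! ### Polynomials in one element of positive degree. -/

section Univariate

variable {k Γ : Type*} [Field k] [AddCommGroup Γ] [LinearOrder Γ] [IsOrderedAddMonoid Γ]
  {n : ℕ} {w : Fin n → Γ} {g : MvPolynomial (Fin n) k} {d a : Γ} {p : Polynomial k}

lemma wdeg_aeval_le {N : ℕ} (hg : wdeg w g = d) (hd : 0 < d) (hp : p.natDegree ≤ N) :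
    wdeg w (Polynomial.aeval g p) ≤ (N • d : Γ) := by
  rw [Polynomial.aeval_eq_sum_range' (Nat.lt_succ_of_le hp)]
  refine wdeg_sum_le _ _ fun i hi => ?_
  rw [smul_eq_C_mul, ← zero_add (N • d)]
  refine wdeg_mul_le_coe (wdeg_C_le _) ((wdeg_pow_coe hg i).trans_le ?_)
  exact_mod_cast nsmul_le_nsmul_left hd.le (Finset.mem_range_succ_iff.1 hi)

lemma component_aeval {N : ℕ} (hg : wdeg w g = d) (hd : 0 < d) (hp : p.natDegree ≤ N) :
    weightedHomogeneousComponent w (N • d) (Polynomial.aeval g p) =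
      C (p.coeff N) * weightedHomogeneousComponent w d g ^ N := by
  rw [Polynomial.aeval_eq_sum_range' (Nat.lt_succ_of_le hp), map_sum, Finset.sum_range_succ,
    Finset.sum_eq_zero, zero_add, map_smul, component_pow hg, smul_eq_C_mul]
  intro i hi
  rw [map_smul, component_eq_zero, smul_zero]
  rw [wdeg_pow_coe hg]
  exact_mod_cast nsmul_lt_nsmul_left hd (Finset.mem_range.1 hi)

/-- Distinct powers of `g` have distinct degrees, so no cancellation can occur. -/
lemma wdeg_aeval (hg : wdeg w g = d) (hd : 0 < d) (hp : p ≠ 0) :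
    wdeg w (Polynomial.aeval g p) = (p.natDegree • d : Γ) := by
  refine le_antisymm (wdeg_aeval_le hg hd le_rfl) (le_wdeg_of_component_ne_zero ?_)
  rw [component_aeval hg hd le_rfl]
  refine mul_ne_zero ?_ (pow_ne_zero _ (component_ne_zero_of_wdeg_eq hg))
  simpa using hp

lemma component_aeval_eq (hg : wdeg w g = d) (hd : 0 < d)
    (ha : wdeg w (Polynomial.aeval g p) ≤ a) :
    weightedHomogeneousComponent w a (Polynomial.aeval g p) = 0 ∨
      a = p.natDegree • d ∧ weightedHomogeneousComponent w a (Polynomial.aeval g p) =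
        C p.leadingCoeff * weightedHomogeneousComponent w d g ^ p.natDegree := by
  by_cases hp : p = 0
  · simp [hp]
  rcases ha.lt_or_eq with h | h
  · exact Or.inl (component_eq_zero h)
  · right
    rw [wdeg_aeval hg hd hp] at h
    obtain rfl : p.natDegree • d = a := by exact_mod_cast h
    exact ⟨rfl, component_aeval hg hd le_rfl⟩

end Univariate

/-! ### Polynomials in two elements: virtual degree, cancellation and derivatives. -/

section Bivariate

variable {k Γ : Type*} [Field k] [AddCommGroup Γ] [LinearOrder Γ]
  {n : ℕ} {w : Fin n → Γ} {g₁ g₂ : MvPolynomial (Fin n) k} {d₁ d₂ v : Γ}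
  {Φ : Polynomial (Polynomial k)}

/-- The value of `Φ ∈ k[y][x]` at `x = g₁`, `y = g₂`. -/
noncomputable def ev (g₁ g₂ : MvPolynomial (Fin n) k) (Φ : Polynomial (Polynomial k)) :
    MvPolynomial (Fin n) k :=
  Φ.eval₂ (Polynomial.aeval g₂ : Polynomial k →ₐ[k] MvPolynomial (Fin n) k).toRingHom g₁

/-- `Φ` has virtual degree at most `v`, when `x` is given degree `d₁`. -/
def VirtualLE (w : Fin n → Γ) (g₂ : MvPolynomial (Fin n) k) (d₁ v : Γ)
    (Φ : Polynomial (Polynomial k)) : Prop :=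
  ∀ i, wdeg w (Polynomial.aeval g₂ (Φ.coeff i)) ≤ (v - i • d₁ : Γ)

/-- The part of `Φ` of virtual degree `v`, with `y` specialised to `g₂`. -/
noncomputable def virtualPart (w : Fin n → Γ) (g₂ : MvPolynomial (Fin n) k) (d₁ v : Γ)
    (Φ : Polynomial (Polynomial k)) : Polynomial (MvPolynomial (Fin n) k) :=
  ∑ i ∈ Finset.range (Φ.natDegree + 1), Polynomial.monomial i
    (weightedHomogeneousComponent w (v - i • d₁) (Polynomial.aeval g₂ (Φ.coeff i)))

lemma coeff_virtualPart (i : ℕ) : (virtualPart w g₂ d₁ v Φ).coeff i =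
    weightedHomogeneousComponent w (v - i • d₁) (Polynomial.aeval g₂ (Φ.coeff i)) := by
  rw [virtualPart, Polynomial.finsetSum_coeff]
  simp only [Polynomial.coeff_monomial, Finset.sum_ite_eq', Finset.mem_range]
  split_ifs with h
  · rfl
  · rw [Polynomial.coeff_eq_zero_of_natDegree_lt (by omega), map_zero, map_zero]

lemma ev_eq_sum : ev g₁ g₂ Φ =
    ∑ i ∈ Finset.range (Φ.natDegree + 1), Polynomial.aeval g₂ (Φ.coeff i) * g₁ ^ i := by
  rw [ev, Polynomial.eval₂_eq_sum_range]
  rfl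

lemma mem_adjoin_pair {h : MvPolynomial (Fin n) k} (hh : h ∈ Algebra.adjoin k {g₁, g₂}) :
    ∃ Φ, ev g₁ g₂ Φ = h := by
  induction hh using Algebra.adjoin_induction with
  | mem x hx =>
    rcases hx with rfl | rfl
    · exact ⟨Polynomial.X, by simp [ev]⟩
    · exact ⟨Polynomial.C Polynomial.X, by simp [ev]⟩
  | algebraMap r => exact ⟨Polynomial.C (Polynomial.C r), by simp [ev]⟩
  | add x y _ _ hx hy =>
    obtain ⟨Φ, rfl⟩ := hx
    obtain ⟨Ψ, rfl⟩ := hy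
    exact ⟨Φ + Ψ, by simp [ev, Polynomial.eval₂_add]⟩
  | mul x y _ _ hx hy =>
    obtain ⟨Φ, rfl⟩ := hx
    obtain ⟨Ψ, rfl⟩ := hy
    exact ⟨Φ * Ψ, by simp [ev, Polynomial.eval₂_mul]⟩

lemma virtualPart_derivative : virtualPart w g₂ d₁ (v - d₁) Φ.derivative =
    (virtualPart w g₂ d₁ v Φ).derivative := by
  ext1 i
  have h : (Polynomial.aeval g₂ ((i : Polynomial k) + 1) : MvPolynomial (Fin n) k) =
      C ((i : k) + 1) := by
    simp
  have hv : v - d₁ - i • d₁ = v - (i + 1) • d₁ := by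
    rw [succ_nsmul]
    abel
  have h' : ((i : MvPolynomial (Fin n) k) + 1) = C ((i : k) + 1) := by
    simp
  rw [coeff_virtualPart, Polynomial.coeff_derivative, Polynomial.coeff_derivative,
    coeff_virtualPart, map_mul, h, hv, mul_comm, weightedHomogeneousComponent_C_mul, mul_comm, h']

lemma virtualPart_iterate_derivative (m : ℕ) :
    virtualPart w g₂ d₁ (v - m • d₁) (Polynomial.derivative^[m] Φ) =
      Polynomial.derivative^[m] (virtualPart w g₂ d₁ v Φ) := by
  induction m with
  | zero => simp
  | succ m ih =>
    rw [Function.iterate_succ_apply', Function.iterate_succ_apply', ← ih, succ_nsmul, ← sub_sub,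
      virtualPart_derivative]

lemma exists_D_ev (g₁ g₂ : MvPolynomial (Fin n) k) (Φ : Polynomial (Polynomial k)) :
    ∃ q : MvPolynomial (Fin n) k, KaehlerDifferential.D k _ (ev g₁ g₂ Φ) =
      ev g₁ g₂ Φ.derivative • KaehlerDifferential.D k _ g₁ +
        q • KaehlerDifferential.D k _ g₂ := by
  induction Φ using Polynomial.induction_on' with
  | add Φ Ψ hΦ hΨ =>
    obtain ⟨p, hp⟩ := hΦ
    obtain ⟨q, hq⟩ := hΨ
    refine ⟨p + q, ?_⟩
    simp only [ev, Polynomial.eval₂_add, map_add, add_smul] at *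
    rw [hp, hq]
    abel
  | monomial i p =>
    refine ⟨g₁ ^ i * Polynomial.aeval g₂ p.derivative, ?_⟩
    simp only [ev, Polynomial.derivative_monomial, Polynomial.eval₂_monomial, Derivation.leibniz,
      AlgHom.toRingHom_eq_coe, RingHom.coe_coe, Derivation.map_aeval, Derivation.leibniz_pow,
      map_mul, map_natCast, smul_smul]
    rw [← Nat.cast_smul_eq_nsmul (MvPolynomial (Fin n) k), smul_smul, smul_smul, mul_assoc]

/-- By the chain rule, wedging with `dg₂` removes the contribution of the `y`-derivative. -/
lemma wedge_D_ev (g₁ g₂ : MvPolynomial (Fin n) k) (Φ : Polynomial (Polynomial k)) :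
    dWedge (ev g₁ g₂ Φ) g₂ = ev g₁ g₂ Φ.derivative • dWedge g₁ g₂ := by
  obtain ⟨q, hq⟩ := exists_D_ev g₁ g₂ Φ
  simp [dWedge_eq_wedge, hq]

variable [IsOrderedAddMonoid Γ]

lemma VirtualLE.derivative (h : VirtualLE w g₂ d₁ v Φ) :
    VirtualLE w g₂ d₁ (v - d₁) Φ.derivative := by
  intro i
  have hv : v - d₁ - i • d₁ = 0 + (v - (i + 1) • d₁) := by
    rw [succ_nsmul]
    abel
  have h' : (Polynomial.aeval g₂ ((i : Polynomial k) + 1) : MvPolynomial (Fin n) k) =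
      C ((i : k) + 1) := by
    simp
  rw [Polynomial.coeff_derivative, map_mul, h', mul_comm, hv]
  exact wdeg_mul_le_coe (wdeg_C_le _) (h (i + 1))

lemma VirtualLE.iterate_derivative (h : VirtualLE w g₂ d₁ v Φ) (m : ℕ) :
    VirtualLE w g₂ d₁ (v - m • d₁) (Polynomial.derivative^[m] Φ) := by
  induction m with
  | zero => simpa using h
  | succ m ih =>
    rw [Function.iterate_succ_apply', succ_nsmul, ← sub_sub]
    exact ih.derivative

lemma VirtualLE.wdeg_ev_le (h : VirtualLE w g₂ d₁ v Φ) (h₁ : wdeg w g₁ = d₁) :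
    wdeg w (ev g₁ g₂ Φ) ≤ v := by
  rw [ev_eq_sum]
  refine wdeg_sum_le _ _ fun i _ => ?_
  rw [← sub_add_cancel v (i • d₁)]
  exact wdeg_mul_le_coe (h i) (wdeg_pow_coe h₁ i).le

/-- Whether the true degree drops below `v` is thus a question about one root of the virtual part.
-/
lemma VirtualLE.component_ev (h : VirtualLE w g₂ d₁ v Φ) (h₁ : wdeg w g₁ = d₁) :
    weightedHomogeneousComponent w v (ev g₁ g₂ Φ) =
      (virtualPart w g₂ d₁ v Φ).eval (weightedHomogeneousComponent w d₁ g₁) := by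
  rw [ev_eq_sum, virtualPart, Polynomial.eval_finsetSum, map_sum]
  refine Finset.sum_congr rfl fun i _ => ?_
  rw [Polynomial.eval_monomial, ← component_pow h₁, ← component_mul (h i) (wdeg_pow_coe h₁ i).le,
    sub_add_cancel]

lemma exists_virtualLE (h₂ : wdeg w g₂ = d₂) (hd₂ : 0 < d₂) (d₁ : Γ) (hΦ : Φ ≠ 0) :
    ∃ v, VirtualLE w g₂ d₁ v Φ ∧ virtualPart w g₂ d₁ v Φ ≠ 0 := by
  obtain ⟨i, hi, hmax⟩ := Φ.support.exists_max_image
    (fun i => (Φ.coeff i).natDegree • d₂ + i • d₁) (Polynomial.support_nonempty.2 hΦ)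
  -- The exact virtual degree: the largest degree of a monomial of `Φ`.
  refine ⟨(Φ.coeff i).natDegree • d₂ + i • d₁, fun j => ?_, fun h => ?_⟩
  · by_cases hj : Φ.coeff j = 0
    · simp [hj]
    · rw [wdeg_aeval h₂ hd₂ hj, WithBot.coe_le_coe, le_sub_iff_add_le]
      exact hmax j (Polynomial.mem_support_iff.2 hj)
  · have := congrArg (Polynomial.coeff · i) h
    simp only [coeff_virtualPart, add_sub_cancel_right, Polynomial.coeff_zero] at this
    exact component_ne_zero_of_wdeg_eq
      (wdeg_aeval h₂ hd₂ (Polynomial.mem_support_iff.1 hi)) this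

lemma VirtualLE.exists_of_coeff_virtualPart_ne_zero (h : VirtualLE w g₂ d₁ v Φ)
    (h₂ : wdeg w g₂ = d₂) (hd₂ : 0 < d₂) {i : ℕ} (hi : (virtualPart w g₂ d₁ v Φ).coeff i ≠ 0) :
    ∃ j : ℕ, v = i • d₁ + j • d₂ := by
  rw [coeff_virtualPart] at hi
  rcases component_aeval_eq h₂ hd₂ (h i) with h' | h'
  · exact absurd h' hi
  · exact ⟨_, by rw [← h'.1]; abel⟩

lemma VirtualLE.eval_virtualPart_mem (h : VirtualLE w g₂ d₁ v Φ)
    (h₁ : wdeg w g₁ = d₁) (h₂ : wdeg w g₂ = d₂) (hd₂ : 0 < d₂) :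
    (virtualPart w g₂ d₁ v Φ).eval (weightedHomogeneousComponent w d₁ g₁) ∈
      Algebra.adjoin k {leadingForm w g₁, leadingForm w g₂} := by
  rw [leadingForm_eq h₁, leadingForm_eq h₂, Polynomial.eval_eq_sum_range]
  refine Subalgebra.sum_mem _ fun i _ => Subalgebra.mul_mem _ ?_ (Subalgebra.pow_mem _
    (Algebra.subset_adjoin (by simp)) _)
  rw [coeff_virtualPart]
  rcases component_aeval_eq h₂ hd₂ (h i) with h' | h'
  · rw [h']
    exact Subalgebra.zero_mem _
  · rw [h'.2]
    exact Subalgebra.mul_mem _ (Subalgebra.algebraMap_mem _ _) (Subalgebra.pow_mem _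
      (Algebra.subset_adjoin (by simp)) _)

section Multiplicity

/-- A polynomial all of whose exponents have the same parity has a nonzero element as a root with
multiplicity at most half the degree. -/
lemma two_mul_rootMultiplicity_le {R : Type*} [CommRing R] [IsDomain R] [CharZero R]
    {T : Polynomial R} {r : R} (hr : r ≠ 0) (hT : T ≠ 0)
    (hpar : ∀ i j, T.coeff i ≠ 0 → T.coeff j ≠ 0 → (Even i ↔ Even j)) :
    2 * T.rootMultiplicity r ≤ T.natDegree := by
  -- Such a `T` is even or odd, so `r` and `-r` are roots of equal multiplicity, and they are
  -- distinct in characteristic zero.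
  have hcomp : T.comp (-Polynomial.X) = T ∨ T.comp (-Polynomial.X) = -T := by
    have hX : (-Polynomial.X : Polynomial R) = Polynomial.C (-1) * Polynomial.X := by simp
    by_cases hN : Even T.natDegree
    · left
      ext i
      rw [hX, Polynomial.comp_C_mul_X_coeff]
      by_cases hi : T.coeff i = 0
      · simp [hi]
      · rw [((hpar i _ hi (by simpa using hT)).2 hN).neg_one_pow, mul_one]
    · right
      ext i
      rw [hX, Polynomial.comp_C_mul_X_coeff]
      by_cases hi : T.coeff i = 0
      · simp [hi]
      · rw [(Nat.not_even_iff_odd.1 (mt (hpar i _ hi (by simpa using hT)).1 hN)).neg_one_pow]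
        simp
  set m := T.rootMultiplicity r with hm
  have h1 : m ≤ T.rootMultiplicity (-r) := by
    rw [Polynomial.le_rootMultiplicity_iff hT]
    have h2 : (Polynomial.X - Polynomial.C r) ^ m ∣ T := Polynomial.pow_rootMultiplicity_dvd T r
    have h3 : (Polynomial.X - Polynomial.C r) ^ m ∣ T.comp (-Polynomial.X) := by
      rcases hcomp with h | h <;> rw [h]
      · exact h2
      · exact h2.neg_right
    rw [Polynomial.dvd_comp_neg_X_iff, Polynomial.pow_comp] at h3
    refine dvd_trans (pow_dvd_pow_of_dvd ⟨-1, ?_⟩ m) h3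
    simp
    ring
  have hne : r ≠ -r := by
    intro h
    exact hr (self_eq_neg.1 h)
  have h4 : Multiset.replicate m r + Multiset.replicate m (-r) ≤ T.roots := by
    classical
    rw [Multiset.le_iff_count]
    intro a
    rw [Multiset.count_add, Multiset.count_replicate, Multiset.count_replicate,
      Polynomial.count_roots]
    split_ifs with h5 h6 h6
    · exact absurd (h5.trans h6.symm) hne
    · simp [← h5, hm]
    · simpa [← h6] using h1
    · simp
  have h5 := (Multiset.card_le_card h4).trans (Polynomial.card_roots' T)
  simp only [Multiset.card_add, Multiset.card_replicate] at h5
  omega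

lemma eval_iterate_derivative_rootMultiplicity_ne_zero {R : Type*} [CommRing R] [IsDomain R]
    [CharZero R] {T : Polynomial R} (r : R) (hT : T ≠ 0) :
    (Polynomial.derivative^[T.rootMultiplicity r] T).eval r ≠ 0 := by
  rw [Polynomial.eval_iterate_derivative_rootMultiplicity, nsmul_eq_mul]
  exact mul_ne_zero (Nat.cast_ne_zero.2 (Nat.factorial_ne_zero _))
    (Polynomial.eval_divByMonic_pow_rootMultiplicity_ne_zero r hT)

end Multiplicity

lemma VirtualLE.two_mul_rootMultiplicity_nsmul_le [CharZero k] (h : VirtualLE w g₂ d₁ v Φ)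
    (h₁ : wdeg w g₁ = d₁) (h₂ : wdeg w g₂ = d₂) (hd₁ : 0 < d₁) (hd₂ : 0 < d₂) {s : ℕ}
    (hs : Odd s) (hd : 2 • d₁ = s • d₂) (h0 : virtualPart w g₂ d₁ v Φ ≠ 0) :
    (2 * (virtualPart w g₂ d₁ v Φ).rootMultiplicity (weightedHomogeneousComponent w d₁ g₁)) • d₁
      ≤ v := by
  set T := virtualPart w g₂ d₁ v Φ
  have hpar : ∀ i j, T.coeff i ≠ 0 → T.coeff j ≠ 0 → (Even i ↔ Even j) := by
    intro i j hi hj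
    obtain ⟨a, ha⟩ := h.exists_of_coeff_virtualPart_ne_zero h₂ hd₂ hi
    obtain ⟨b, hb⟩ := h.exists_of_coeff_virtualPart_ne_zero h₂ hd₂ hj
    -- Doubling expresses everything in multiples of `d₂`; as `s` is odd, `v` then fixes the parity
    -- of the exponent of `x`.
    have hi' : 2 • v = (i * s + 2 * a) • d₂ := by
      rw [ha, smul_add, smul_comm, hd, add_smul, mul_smul, mul_smul]
    have hj' : 2 • v = (j * s + 2 * b) • d₂ := by
      rw [hb, smul_add, smul_comm, hd, add_smul, mul_smul, mul_smul]
    have := (nsmul_left_strictMono hd₂).injective (hi'.symm.trans hj')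
    have h2 : Even (i * s) ↔ Even (j * s) := by
      have e1 : Even (i * s + 2 * a) ↔ Even (j * s + 2 * b) := by rw [this]
      simpa [Nat.even_add] using e1
    simpa [Nat.even_mul, Nat.not_even_iff_odd.2 hs] using h2
  have hle := two_mul_rootMultiplicity_le (component_ne_zero_of_wdeg_eq h₁) h0 hpar
  obtain ⟨j, hj⟩ := h.exists_of_coeff_virtualPart_ne_zero h₂ hd₂ (i := T.natDegree)
    (Polynomial.leadingCoeff_ne_zero.2 h0)
  rw [hj]
  exact (nsmul_le_nsmul_left hd₁.le hle).trans (le_add_of_nonneg_right (nsmul_nonneg hd₂.le j))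

/-- Differentiating as often as the multiplicity of the root leaves a virtual part that no longer
vanishes there, so the degree is at least the virtual one. -/
lemma le_wdeg_iterate_derivative_ev [CharZero k] (h : VirtualLE w g₂ d₁ v Φ)
    (h₁ : wdeg w g₁ = d₁) (h0 : virtualPart w g₂ d₁ v Φ ≠ 0) {m : ℕ}
    (hm : (virtualPart w g₂ d₁ v Φ).rootMultiplicity (weightedHomogeneousComponent w d₁ g₁) = m) :
    ((v - m • d₁ : Γ) : WithBot Γ) ≤ wdeg w (ev g₁ g₂ (Polynomial.derivative^[m] Φ)) := by
  apply le_wdeg_of_component_ne_zero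
  rw [(h.iterate_derivative m).component_ev h₁, virtualPart_iterate_derivative, ← hm]
  exact eval_iterate_derivative_rootMultiplicity_ne_zero _ h0

/-- Compares the exact degree of `ev g₁ g₂ Φ.derivative • dWedge g₁ g₂` with the general upper bound
for the same form, `dWedge (ev g₁ g₂ Φ) g₂`. -/
lemma wdeg_ev_derivative_add_le {D : Γ} (h₂ : wdeg w g₂ = d₂)
    (hD : formDeg w (dWedge g₁ g₂) = D) (Φ : Polynomial (Polynomial k)) :
    wdeg w (ev g₁ g₂ Φ.derivative) + D ≤ wdeg w (ev g₁ g₂ Φ) + d₂ := by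
  have h := formDeg_smul (w := w) (ω := dWedge g₁ g₂) (ev g₁ g₂ Φ.derivative)
  rw [← wedge_D_ev, hD] at h
  rw [← h]
  by_cases h0 : ev g₁ g₂ Φ = 0
  · rw [h0]
    simp [dWedge_eq_wedge]
  · obtain ⟨a, ha⟩ := exists_wdeg_eq_coe (w := w) h0
    rw [ha]
    exact formDeg_dWedge_le ha.le h₂.le

/-- Iterated descent along derivatives. -/
lemma le_wdeg_ev_of_le_iterate {D : Γ} (h₂ : wdeg w g₂ = d₂)
    (hD : formDeg w (dWedge g₁ g₂) = D) (m : ℕ) : ∀ (Φ : Polynomial (Polynomial k)) (a : Γ),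
    (a : WithBot Γ) ≤ wdeg w (ev g₁ g₂ (Polynomial.derivative^[m] Φ)) →
    ((a + m • (D - d₂) : Γ) : WithBot Γ) ≤ wdeg w (ev g₁ g₂ Φ) := by
  induction m with
  | zero =>
    intro Φ a h
    simpa using h
  | succ m ih =>
    intro Φ a h
    rw [Function.iterate_succ_apply] at h
    have h1 := ih _ _ h
    have h2 := wdeg_ev_derivative_add_le h₂ hD Φ
    have h3 : ((a + m • (D - d₂) : Γ) : WithBot Γ) + D ≤ wdeg w (ev g₁ g₂ Φ) + d₂ :=
      (add_le_add_left h1 _).trans h2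
    by_cases h0 : ev g₁ g₂ Φ = 0
    · rw [h0, wdeg_zero, WithBot.bot_add, le_bot_iff] at h3
      simp [← WithBot.coe_add] at h3
    · obtain ⟨b, hb⟩ := exists_wdeg_eq_coe (w := w) h0
      rw [hb] at h3 ⊢
      norm_cast at h3 ⊢
      rw [succ_nsmul]
      grind

end Bivariate

end ShestakovUmirbaev

namespace ShestakovUmirbaev

/-! ### Consequences of the relation `2 d₁ = s d₂` with `s` odd. -/

section Pairs

variable {k Γ : Type*} [Field k] [AddCommGroup Γ] [LinearOrder Γ] {n : ℕ}

/-- The numerical data of a pair `g₁, g₂` with `(g₁^w)² ≈ (g₂^w)^s`: the degrees `d₁, d₂` and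
`D = deg (dg₁ ∧ dg₂)`. -/
structure PairData (w : Fin n → Γ) (g₁ g₂ : MvPolynomial (Fin n) k) (d₁ d₂ D : Γ) (s : ℕ) :
    Prop where
  wdeg₁ : wdeg w g₁ = d₁
  wdeg₂ : wdeg w g₂ = d₂
  formDeg_eq : formDeg w (dWedge g₁ g₂) = D
  pos₁ : 0 < d₁
  pos₂ : 0 < d₂
  pos : 0 < D
  odd : Odd s
  three_le : 3 ≤ s
  two_nsmul : 2 • d₁ = s • d₂

variable [IsOrderedAddMonoid Γ] {w : Fin n → Γ} {g₁ g₂ : MvPolynomial (Fin n) k} {d₁ d₂ D v : Γ}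
  {s : ℕ} {Φ : Polynomial (Polynomial k)}

lemma PairData.three_nsmul_le (h : PairData w g₁ g₂ d₁ d₂ D s) : 3 • d₂ ≤ 2 • d₁ := by
  rw [h.two_nsmul]
  exact nsmul_le_nsmul_left h.pos₂.le h.three_le

lemma PairData.exponent_eq (h : PairData w g₁ g₂ d₁ d₂ D s) (hlt : d₁ < 2 • d₂) : s = 3 := by
  obtain ⟨r, hr⟩ := h.odd
  have h3 := h.three_le
  by_contra hne
  have h5 : 5 • d₂ ≤ 2 • d₁ := by
    rw [h.two_nsmul]
    exact nsmul_le_nsmul_left h.pos₂.le (by omega)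
  have := h.pos₂
  grind

/-- A version of the Shestakov-Umirbaev inequality. -/
lemma PairData.exists_virtual [CharZero k] (h : PairData w g₁ g₂ d₁ d₂ D s) (hΦ : Φ ≠ 0) :
    ∃ (v : Γ) (m : ℕ), VirtualLE w g₂ d₁ v Φ ∧ virtualPart w g₂ d₁ v Φ ≠ 0 ∧
      (virtualPart w g₂ d₁ v Φ).rootMultiplicity (weightedHomogeneousComponent w d₁ g₁) = m ∧
      (2 * m) • d₁ ≤ v ∧
      ((v + m • (D - d₁ - d₂) : Γ) : WithBot Γ) ≤ wdeg w (ev g₁ g₂ Φ) ∧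
      (m • (d₁ - d₂ + D) : Γ) ≤ wdeg w (ev g₁ g₂ Φ) ∧
      (m ≠ 0 → (d₁ : WithBot Γ) ≤ wdeg w (ev g₁ g₂ Φ.derivative)) := by
  obtain ⟨v, hv, h0⟩ := exists_virtualLE h.wdeg₂ h.pos₂ d₁ hΦ
  obtain ⟨m, hm⟩ : ∃ m, (virtualPart w g₂ d₁ v Φ).rootMultiplicity
    (weightedHomogeneousComponent w d₁ g₁) = m := ⟨_, rfl⟩
  have h2m := hv.two_mul_rootMultiplicity_nsmul_le h.wdeg₁ h.wdeg₂ h.pos₁ h.pos₂ h.odd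
    h.two_nsmul h0
  rw [hm] at h2m
  have hder := le_wdeg_iterate_derivative_ev hv h.wdeg₁ h0 hm
  have h1 := le_wdeg_ev_of_le_iterate h.wdeg₂ h.formDeg_eq m Φ _ hder
  have e1 : v - m • d₁ + m • (D - d₂) = v + m • (D - d₁ - d₂) := by
    simp only [smul_sub]
    abel
  rw [e1] at h1
  have hpos : 0 ≤ d₁ - d₂ + D := by
    have := h.three_nsmul_le
    have := h.pos
    have := h.pos₂
    grind
  refine ⟨v, m, hv, h0, hm, h2m, h1, le_trans ?_ h1, fun hm0 => ?_⟩
  · rw [WithBot.coe_le_coe]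
    calc m • (d₁ - d₂ + D) = (2 * m) • d₁ + m • (D - d₁ - d₂) := by
          rw [two_mul, add_smul]
          simp only [smul_sub, smul_add]
          abel
      _ ≤ _ := by gcongr
  -- Only `m - 1` descents are made, stopping at the first derivative of `Φ` instead of at `Φ`.
  · obtain ⟨r, rfl⟩ := Nat.exists_eq_succ_of_ne_zero hm0
    rw [Function.iterate_succ_apply] at hder
    refine le_trans ?_ (le_wdeg_ev_of_le_iterate h.wdeg₂ h.formDeg_eq r Φ.derivative _ hder)
    rw [WithBot.coe_le_coe]
    calc d₁ ≤ d₁ + r • (d₁ - d₂ + D) := le_add_of_nonneg_right (nsmul_nonneg hpos r)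
      _ = (2 * (r + 1)) • d₁ - (r + 1) • d₁ + r • (D - d₂) := by
          simp only [two_mul, add_smul, smul_sub, smul_add, one_smul]
          abel
      _ ≤ _ := by gcongr

lemma PairData.wdeg_ev_eq (h : PairData w g₁ g₂ d₁ d₂ D s)
    (hv : VirtualLE w g₂ d₁ v Φ) (h0 : virtualPart w g₂ d₁ v Φ ≠ 0)
    (hm : (virtualPart w g₂ d₁ v Φ).rootMultiplicity (weightedHomogeneousComponent w d₁ g₁) = 0) :
    wdeg w (ev g₁ g₂ Φ) = v := by
  refine le_antisymm (hv.wdeg_ev_le h.wdeg₁) (le_wdeg_of_component_ne_zero ?_)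
  rw [hv.component_ev h.wdeg₁]
  intro h'
  rw [Polynomial.rootMultiplicity_eq_zero_iff] at hm
  exact h0 (hm h')

/-- An element of `k[g₁, g₂]` of small degree lies in `k[g₂]`. -/
lemma PairData.mem_adjoin_singleton [CharZero k] (h : PairData w g₁ g₂ d₁ d₂ D s)
    {f : MvPolynomial (Fin n) k} (hf : f ∈ Algebra.adjoin k {g₁, g₂})
    (hf₁ : wdeg w f < d₁) (hf₂ : wdeg w f < (d₁ - d₂ + D : Γ)) :
    f ∈ Algebra.adjoin k {g₂} := by
  obtain ⟨Φ, rfl⟩ := mem_adjoin_pair hf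
  by_cases hΦ : Φ = 0
  · rw [hΦ, ev, Polynomial.eval₂_zero]
    exact Subalgebra.zero_mem _
  obtain ⟨v, m, hv, h0, hm, h2m, -, h1, -⟩ := h.exists_virtual hΦ
  obtain rfl : m = 0 := by
    by_contra hm0
    refine hf₂.not_ge (le_trans ?_ h1)
    rw [WithBot.coe_le_coe]
    conv_lhs => rw [← one_nsmul (d₁ - d₂ + D)]
    refine nsmul_le_nsmul_left ?_ (Nat.one_le_iff_ne_zero.2 hm0)
    have := h.three_nsmul_le
    have := h.pos
    have := h.pos₂
    grind
  rw [h.wdeg_ev_eq hv h0 hm, WithBot.coe_lt_coe] at hf₁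
  rw [ev_eq_sum]
  refine Subalgebra.sum_mem _ fun i _ => ?_
  rcases Nat.eq_zero_or_pos i with rfl | hi
  · simp
  · suffices Φ.coeff i = 0 by simp [this]
    by_contra hc
    have h3 := hv i
    rw [wdeg_aeval h.wdeg₂ h.pos₂ hc, WithBot.coe_le_coe] at h3
    have h4 := nsmul_nonneg h.pos₂.le (Φ.coeff i).natDegree
    have h5 : 1 • d₁ ≤ i • d₁ := nsmul_le_nsmul_left h.pos₁.le hi
    rw [one_nsmul] at h5
    have h6 := h4.trans h3
    rw [sub_nonneg] at h6
    exact hf₁.not_ge (h5.trans h6)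

/-- If `d₁ : d₂ = 3 : 2` and the part of `Φ` of virtual degree `2 d₁` cancels at `(g₁, g₂)`, then
the `y`-derivative of `Φ` does not drop in degree. -/
lemma PairData.exists_dWedge_ev_eq_smul [CharZero k] (h : PairData w g₁ g₂ d₁ d₂ D 3)
    (hv : VirtualLE w g₂ d₁ (2 • d₁) Φ) (h0 : virtualPart w g₂ d₁ (2 • d₁) Φ ≠ 0)
    (hroot : (virtualPart w g₂ d₁ (2 • d₁) Φ).eval (weightedHomogeneousComponent w d₁ g₁) = 0) :
    ∃ q : MvPolynomial (Fin n) k, wdeg w q = (2 • d₂ : Γ) ∧ dWedge (ev g₁ g₂ Φ) g₁ = q • dWedge g₂ g₁ := by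
  have hd := h.two_nsmul
  have p₁ := h.pos₁
  have p₂ := h.pos₂
  -- Virtual degree at most `2 d₁ = 3 d₂` leaves only the monomials `1, y, y², y³, x, xy, x²`.
  have hnat : ∀ i, Φ.coeff i ≠ 0 → (Φ.coeff i).natDegree • d₂ + i • d₁ ≤ 2 • d₁ := by
    intro i hi
    have := hv i
    rwa [wdeg_aeval h.wdeg₂ h.pos₂ hi, WithBot.coe_le_coe, le_sub_iff_add_le] at this
  have hΦ : Φ.natDegree < 3 := by
    by_contra! h3
    have hne : Φ ≠ 0 := by
      rintro rfl
      simp at h3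
    have h1 := hnat Φ.natDegree (Polynomial.leadingCoeff_ne_zero.2 hne)
    have h2 := nsmul_nonneg p₂.le (Φ.coeff Φ.natDegree).natDegree
    have h4 : 3 • d₁ ≤ Φ.natDegree • d₁ := nsmul_le_nsmul_left p₁.le h3
    have h5 := (h4.trans (le_add_of_nonneg_left h2)).trans h1
    grind
  have hp0 : (Φ.coeff 0).natDegree ≤ 3 := by
    by_cases hc : Φ.coeff 0 = 0
    · simp [hc]
    · have := hnat 0 hc
      rwa [zero_smul, add_zero, hd, nsmul_le_nsmul_iff_left p₂] at this
  have hp1 : (Φ.coeff 1).natDegree ≤ 1 := by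
    by_cases hc : Φ.coeff 1 = 0
    · simp [hc]
    · have h1 := hnat 1 hc
      by_contra! h2
      have h3 : 2 • d₂ ≤ (Φ.coeff 1).natDegree • d₂ := nsmul_le_nsmul_left p₂.le h2
      grind
  have hp2 : (Φ.coeff 2).natDegree = 0 := by
    by_cases hc : Φ.coeff 2 = 0
    · simp [hc]
    · have h1 := hnat 2 hc
      by_contra h2
      have h3 : 1 • d₂ ≤ (Φ.coeff 2).natDegree • d₂ :=
        nsmul_le_nsmul_left p₂.le (Nat.one_le_iff_ne_zero.2 h2)
      grind
  -- Without `y³` the virtual part would be a multiple of `x²` alone, because an `x`-linear term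
  -- would need `3 = 2j`; that has no nonzero root.
  have hc3 : (Φ.coeff 0).coeff 3 ≠ 0 := by
    intro hc
    have hT : (virtualPart w g₂ d₁ (2 • d₁) Φ).natDegree < 3 := by
      rw [Nat.lt_succ_iff, Polynomial.natDegree_le_iff_coeff_eq_zero]
      intro i hi
      rw [coeff_virtualPart, Polynomial.coeff_eq_zero_of_natDegree_lt (by omega), map_zero,
        map_zero]
    have hT0 : (virtualPart w g₂ d₁ (2 • d₁) Φ).coeff 0 = 0 := by
      rw [coeff_virtualPart, zero_smul, sub_zero, hd, component_aeval h.wdeg₂ p₂ hp0, hc]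
      simp
    have hT1 : (virtualPart w g₂ d₁ (2 • d₁) Φ).coeff 1 = 0 := by
      by_contra hne
      obtain ⟨j, hj⟩ := hv.exists_of_coeff_virtualPart_ne_zero h.wdeg₂ p₂ hne
      have : 3 • d₂ = (2 * j) • d₂ := by
        rw [mul_smul, ← hd]
        grind
      have := (nsmul_left_strictMono p₂).injective this
      omega
    rw [Polynomial.eval_eq_sum_range' hT] at hroot
    simp only [Finset.sum_range_succ, Finset.sum_range_zero, hT0, hT1, zero_mul, zero_add] at hroot
    have hT2 := (mul_eq_zero.1 hroot).resolve_right
      (pow_ne_zero _ (component_ne_zero_of_wdeg_eq h.wdeg₁))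
    apply h0
    ext1 i
    rcases lt_or_ge i 3 with hi | hi
    · interval_cases i <;> simp [hT0, hT1, hT2]
    · rw [Polynomial.coeff_eq_zero_of_natDegree_lt (by omega), Polynomial.coeff_zero]
  -- The witness is `∂Φ/∂y` at `(g₁, g₂)`; its `y²` term, coming from `y³`, dominates since `d₁ < 2
  -- d₂`.
  refine ⟨Polynomial.aeval g₂ (Φ.coeff 0).derivative +
    Polynomial.aeval g₂ (Φ.coeff 1).derivative * g₁, ?_, ?_⟩
  · have hlead : (Φ.coeff 0).derivative.coeff 2 ≠ 0 := by
      rw [Polynomial.coeff_derivative]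
      refine mul_ne_zero hc3 ?_
      norm_num
    have hnd : (Φ.coeff 0).derivative.natDegree = 2 :=
      le_antisymm ((Polynomial.natDegree_derivative_le _).trans (by omega))
        (Polynomial.le_natDegree_of_ne_zero hlead)
    have hA : wdeg w (Polynomial.aeval g₂ (Φ.coeff 0).derivative) = (2 • d₂ : Γ) := by
      rw [wdeg_aeval h.wdeg₂ p₂ (by rintro h'; simp [h'] at hlead), hnd]
    rw [wdeg_add_eq_left, hA]
    rw [hA]
    refine lt_of_le_of_lt (wdeg_mul_le_coe (wdeg_aeval_le (N := 0) h.wdeg₂ p₂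
      ((Polynomial.natDegree_derivative_le _).trans (by omega))) h.wdeg₁.le) ?_
    rw [WithBot.coe_lt_coe]
    grind
  · obtain ⟨c, hc⟩ := Polynomial.natDegree_eq_zero.1 hp2
    have hev : ev g₁ g₂ Φ = Polynomial.aeval g₂ (Φ.coeff 0) +
        Polynomial.aeval g₂ (Φ.coeff 1) * g₁ + C c * g₁ ^ 2 := by
      rw [ev, Polynomial.eval₂_eq_sum_range' _ hΦ]
      simp [Finset.sum_range_succ, ← hc, algebraMap_eq]
    have hDC : KaehlerDifferential.D k (MvPolynomial (Fin n) k) (C c) = 0 :=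
      Derivation.map_algebraMap _ c
    rw [hev, dWedge_eq_wedge, dWedge_eq_wedge]
    simp [Derivation.map_aeval, Derivation.leibniz, Derivation.leibniz_pow, hDC, add_smul,
      mul_smul, mul_comm]

end Pairs

end ShestakovUmirbaev

namespace ShestakovUmirbaev

/-! ### Degree estimates drawn from the Shestakov-Umirbaev condition. -/

section Condition

variable {k Γ : Type*} [Field k] [AddCommGroup Γ] [LinearOrder Γ] [IsOrderedAddMonoid Γ] {n : ℕ}
  {w : Fin n → Γ}

lemma Approx.nsmul_eq {f g : MvPolynomial (Fin n) k} {a b : Γ} {p q : ℕ} (hf : wdeg w f = a)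
    (hg : wdeg w g = b) (h : Approx (leadingForm w f ^ p) (leadingForm w g ^ q)) :
    p • a = q • b := by
  have hx := wdeg_pow_coe (wdeg_leadingForm hf) p
  have hy := wdeg_pow_coe (wdeg_leadingForm hg) q
  have hx0 := ne_zero_of_wdeg_eq_coe hx
  have hy0 := ne_zero_of_wdeg_eq_coe hy
  rw [Approx, LinearIndependent.pair_iff] at h
  push Not at h
  obtain ⟨c, e, hce, hne⟩ := h
  have hc : c ≠ 0 := by
    rintro rfl
    rw [zero_smul, zero_add, smul_eq_zero] at hce
    exact hne rfl (hce.resolve_right hy0)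
  have he : e ≠ 0 := by
    rintro rfl
    rw [zero_smul, add_zero, smul_eq_zero] at hce
    exact hc (hce.resolve_right hx0)
  have heq := congrArg (wdeg w) (eq_neg_of_add_eq_zero_left hce)
  rw [wdeg_neg, smul_eq_C_mul, smul_eq_C_mul, wdeg_mul, wdeg_mul, wdeg_C hc, wdeg_C he, hx, hy,
    zero_add, zero_add] at heq
  exact_mod_cast heq

variable {F G : Fin 3 → MvPolynomial (Fin n) k}

lemma SUCondition.exists_pairData (hw : ∀ i, 0 < w i) (h : SUCondition w F G) :
    ∃ (d₁ d₂ D : Γ) (s : ℕ), PairData w (G 0) (G 1) d₁ d₂ D s ∧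
      wdeg w (G 2) < (d₁ - d₂ + D : Γ) := by
  have h6 := h.su6
  -- The strict inequality (SU6) excludes `-∞` on its right side, which yields all the nonvanishing
  -- needed.
  have hG0 : G 0 ≠ 0 := by
    intro h0
    rw [h0, wdeg_zero, WithBot.bot_add] at h6
    exact not_lt_bot h6
  have hDbot : formDeg w (dWedge (G 0) (G 1)) ≠ ⊥ := by
    intro h0
    rw [h0, WithBot.add_bot] at h6
    exact not_lt_bot h6
  have hG1 : G 1 ≠ 0 := by
    intro h0
    apply hDbot
    rw [h0]
    simp [dWedge_eq_wedge]
  obtain ⟨d₁, h₁⟩ := exists_wdeg_eq_coe (w := w) hG0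
  obtain ⟨d₂, h₂⟩ := exists_wdeg_eq_coe (w := w) hG1
  obtain ⟨D, hD⟩ := WithBot.ne_bot_iff_exists.1 hDbot
  obtain ⟨s, hs, hs3, happ⟩ := h.su3
  have hd := happ.nsmul_eq h₁ h₂
  have hDpos : 0 < D := by
    have := formDeg_pos hw two_ne_zero hDbot
    rw [← hD] at this
    exact_mod_cast this
  have hDle : D ≤ d₁ + d₂ := by
    have := formDeg_dWedge_le h₁.le h₂.le
    rw [← hD] at this
    exact_mod_cast this
  -- By `2 d₁ = s d₂` the two degrees have the same sign, and `0 < D ≤ d₁ + d₂`.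
  have hpos₂ : 0 < d₂ := by
    by_contra! hle
    have h3 : s • d₂ ≤ 0 := nsmul_nonpos hle s
    grind
  have hpos₁ : 0 < d₁ := by
    by_contra! hle
    have h3 : 0 < s • d₂ := nsmul_pos hpos₂ (by omega)
    grind
  refine ⟨d₁, d₂, D, s, ⟨h₁, h₂, hD.symm, hpos₁, hpos₂, hDpos, hs, hs3, hd⟩, ?_⟩
  by_cases hG2 : G 2 = 0
  · rw [hG2, wdeg_zero]
    exact WithBot.bot_lt_coe _
  · obtain ⟨c, hc⟩ := exists_wdeg_eq_coe (w := w) hG2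
    rw [hc, h₁, h₂, ← hD] at h6
    rw [hc]
    norm_cast at h6 ⊢
    grind

lemma formDeg_dWedge_lt {f g : MvPolynomial (Fin n) k} {a b c : Γ} (hf : wdeg w f < a)
    (hg : wdeg w g = b) (hc : a + b ≤ c) : formDeg w (dWedge f g) < c := by
  by_cases h0 : f = 0
  · rw [h0]
    simp [dWedge_eq_wedge]
  · obtain ⟨e, he⟩ := exists_wdeg_eq_coe (w := w) h0
    rw [he, WithBot.coe_lt_coe] at hf
    refine (formDeg_dWedge_le he.le hg.le).trans_lt ?_
    rw [WithBot.coe_lt_coe]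
    grind

lemma dWedge_add_left (f f' g : MvPolynomial (Fin n) k) :
    dWedge (f + f') g = dWedge f g + dWedge f' g := by
  simp [dWedge_eq_wedge]

lemma dWedge_swap (f g : MvPolynomial (Fin n) k) : dWedge f g = -dWedge g f :=
  wedge_swap _ _

/-- Degree estimates for `f₃` and for `df₃ ∧ dg₁`, `df₃ ∧ dg₂` under the Shestakov-Umirbaev
condition. -/
lemma SUCondition.estimates [CharZero k] (h : SUCondition w F G) {d₁ d₂ D : Γ} {s : ℕ}
    (hp : PairData w (G 0) (G 1) d₁ d₂ D s) (hG2 : wdeg w (G 2) < (d₁ - d₂ + D : Γ)) :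
    ∃ t : Γ, wdeg w (F 2) = t ∧ t ≤ d₁ ∧ d₁ - d₂ + D ≤ t ∧
      ((d₁ + D : Γ) : WithBot Γ) ≤ formDeg w (dWedge (F 2) (G 1)) ∧
      (t ≤ d₂ → 2 • d₁ = 3 • d₂ ∧ formDeg w (dWedge (F 2) (G 0)) = (2 • d₂ + D : Γ)) := by
  have hF2 : F 2 ≠ 0 := by
    intro h0
    have := h.su5
    rw [h0, wdeg_zero] at this
    exact not_lt_bot this
  obtain ⟨t, ht⟩ := exists_wdeg_eq_coe (w := w) hF2
  have htd : t ≤ d₁ := by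
    have := h.su4.1
    rw [ht, hp.wdeg₁] at this
    exact_mod_cast this
  have hmem : F 2 - G 2 ∈ Algebra.adjoin k {G 0, G 1} := by
    rw [← neg_sub]
    exact Subalgebra.neg_mem _ h.su1.2
  obtain ⟨Φ, hΦ⟩ := mem_adjoin_pair hmem
  have hF : F 2 = ev (G 0) (G 1) Φ + G 2 := by rw [hΦ, sub_add_cancel]
  have hdeg : wdeg w (ev (G 0) (G 1) Φ) = t := by
    rw [hΦ, sub_eq_add_neg, wdeg_add_eq_left, ht]
    rw [wdeg_neg]
    exact h.su5
  have hΦ0 : Φ ≠ 0 := by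
    rintro rfl
    simp [ev] at hdeg
  obtain ⟨v, m, hv, h0, hm, h2m, h1, hmt, hder⟩ := hp.exists_virtual hΦ0
  -- With no cancellation, the leading form of `F 2` would be the top part of `Φ` evaluated at the
  -- leading forms, against (SU4).
  have hm0 : m ≠ 0 := by
    rintro rfl
    have hvt := hp.wdeg_ev_eq hv h0 hm
    obtain rfl : t = v := by
      rw [hdeg] at hvt
      exact_mod_cast hvt
    apply h.su4.2
    rw [leadingForm_eq ht, hF, map_add, component_eq_zero (f := G 2), add_zero,
      hv.component_ev hp.wdeg₁]
    · exact hv.eval_virtualPart_mem hp.wdeg₁ hp.wdeg₂ hp.pos₂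
    · rw [← ht]
      exact h.su5
  rw [hdeg, WithBot.coe_le_coe] at h1 hmt
  have p := hp.pos
  have p₁ := hp.pos₁
  have p₂ := hp.pos₂
  have h3 := hp.three_nsmul_le
  have hnonneg : 0 ≤ d₁ - d₂ + D := by grind
  have htge : d₁ - d₂ + D ≤ t := by
    have := nsmul_le_nsmul_left hnonneg (Nat.one_le_iff_ne_zero.2 hm0)
    rw [one_nsmul] at this
    exact this.trans hmt
  refine ⟨t, ht, htd, htge, ?_, fun htd₂ => ?_⟩
  · have hE : ((d₁ + D : Γ) : WithBot Γ) ≤ formDeg w (dWedge (ev (G 0) (G 1) Φ) (G 1)) := by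
      rw [wedge_D_ev, formDeg_smul, hp.formDeg_eq, WithBot.coe_add]
      exact add_le_add_left (hder hm0) _
    rw [hF, dWedge_add_left, formDeg_add_eq_left]
    · exact hE
    · exact (formDeg_dWedge_lt hG2 hp.wdeg₂ (by grind)).trans_le hE
  -- Here `d₁ - d₂ + D ≤ t ≤ d₂` gives `d₁ < 2 d₂`.
  · obtain rfl := hp.exponent_eq (by grind)
    have hd := hp.two_nsmul
    refine ⟨hd, ?_⟩
    obtain rfl : m = 1 := by
      by_contra hne
      have := nsmul_le_nsmul_left hnonneg (show 2 ≤ m by omega)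
      grind
    -- From `v + D - d₁ - d₂ ≤ t ≤ d₂` and `2 d₁ ≤ v` one gets `6 d₂ ≤ 2 v < 7 d₂`, and `2 v` is an
    -- integer multiple of `d₂`.
    obtain rfl : v = 2 • d₁ := by
      obtain ⟨i, hi⟩ : ∃ i, (virtualPart w (G 1) d₁ v Φ).coeff i ≠ 0 := by
        by_contra! hne
        exact h0 (Polynomial.ext (by simpa using hne))
      obtain ⟨j, hj⟩ := hv.exists_of_coeff_virtualPart_ne_zero hp.wdeg₂ p₂ hi
      have h2v : 2 • v = (3 * i + 2 * j) • d₂ := by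
        rw [hj, smul_add, smul_comm, hd, add_smul, mul_smul, mul_smul, smul_comm 3 i]
      have hlt : (3 * i + 2 * j) • d₂ < 7 • d₂ := by
        rw [← h2v]
        grind
      have hge : 6 • d₂ ≤ (3 * i + 2 * j) • d₂ := by
        rw [← h2v]
        grind
      have hlt' := (nsmul_left_strictMono p₂).lt_iff_lt.1 hlt
      have hge' := (nsmul_le_nsmul_iff_left p₂).1 hge
      rw [show 3 * i + 2 * j = 6 by omega] at h2v
      grind
    have hroot : (virtualPart w (G 1) d₁ (2 • d₁) Φ).eval
        (weightedHomogeneousComponent w d₁ (G 0)) = 0 :=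
      (Polynomial.rootMultiplicity_pos h0).1 (by omega)
    obtain ⟨q, hq, hq'⟩ := hp.exists_dWedge_ev_eq_smul hv h0 hroot
    have hE : formDeg w (dWedge (ev (G 0) (G 1) Φ) (G 0)) = (2 • d₂ + D : Γ) := by
      rw [hq', formDeg_smul, hq, dWedge_swap, formDeg_neg, hp.formDeg_eq, WithBot.coe_add]
    rw [hF, dWedge_add_left, formDeg_add_eq_left, hE]
    rw [hE]
    exact formDeg_dWedge_lt hG2 hp.wdeg₁ (by grind)

end Condition

end ShestakovUmirbaev

namespace ShestakovUmirbaev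

/-! ### Uniqueness of the modification of the first two entries. -/

section Uniqueness

variable {k Γ : Type*} [Field k] [AddCommGroup Γ] [LinearOrder Γ] [IsOrderedAddMonoid Γ] {n : ℕ}
  {w : Fin n → Γ}

lemma D_C (c : k) : KaehlerDifferential.D k (MvPolynomial (Fin n) k) (C c) = 0 :=
  Derivation.map_algebraMap _ c

lemma dWedge_add_C_mul (f g : MvPolynomial (Fin n) k) (b : k) :
    dWedge f (g + C b * f) = dWedge f g := by
  simp [dWedge_eq_wedge, Derivation.leibniz]

lemma dWedge_add_C_mul_sq (f g : MvPolynomial (Fin n) k) (a c : k) :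
    dWedge f (g + C a * f ^ 2 + C c * f) = dWedge f g := by
  simp [dWedge_eq_wedge, Derivation.leibniz, Derivation.leibniz_pow]

lemma dWedge_perturb (f g₁ g₂ : MvPolynomial (Fin n) k) (a b c : k) :
    dWedge (g₁ + C a * f ^ 2 + C c * f) (g₂ + C b * f) =
      dWedge g₁ g₂ + (-C b : MvPolynomial (Fin n) k) • dWedge f g₁ +
        (C (2 * a) * f + C c) • dWedge f g₂ := by
  have h := wedge_swap (KaehlerDifferential.D k _ g₁) (KaehlerDifferential.D k _ f)
  simp only [dWedge_eq_wedge, sq, Derivation.leibniz, D_C, map_add, map_smul, LinearMap.add_apply,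
    LinearMap.smul_apply, wedge_self, smul_zero, add_zero, h, two_mul]
  module

/-- The degree data of a pair satisfying the Shestakov-Umirbaev condition determine the elementary
modification: two such pairs over the same `f` cannot differ. -/
lemma perturb_eq_zero [CharZero k] {f g₁ g₂ g₁' g₂' : MvPolynomial (Fin n) k}
    {d₁ d₁' d₂ D D' t : Γ} {s s' : ℕ} {a b c : k}
    (h : PairData w g₁ g₂ d₁ d₂ D s) (h' : PairData w g₁' g₂' d₁' d₂ D' s')
    (hg₁ : g₁' = g₁ + C a * f ^ 2 + C c * f) (hg₂ : g₂' = g₂ + C b * f)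
    (ht : wdeg w f = t) (hlow : d₁ - d₂ + D ≤ t)
    (hE : ((d₁ + D : Γ) : WithBot Γ) ≤ formDeg w (dWedge f g₂))
    (hE' : ((d₁' + D' : Γ) : WithBot Γ) ≤ formDeg w (dWedge f g₂'))
    (hsmall : t ≤ d₂ → 2 • d₁ = 3 • d₂ ∧ formDeg w (dWedge f g₁) = (2 • d₂ + D : Γ))
    (hsmall' : t ≤ d₂ → 2 • d₁' = 3 • d₂ ∧ formDeg w (dWedge f g₁') = (2 • d₂ + D' : Γ)) :
    a = 0 ∧ b = 0 ∧ c = 0 := by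
  have hω : formDeg w (dWedge g₁' g₂') = D' := h'.formDeg_eq
  rw [hg₂, dWedge_add_C_mul] at hE'
  rw [hg₁, dWedge_add_C_mul_sq] at hsmall'
  rw [hg₁, hg₂, dWedge_perturb] at hω
  have p := h.pos
  have p' := h'.pos
  have p₁ := h.pos₁
  have p₁' := h'.pos₁
  have p₂ := h.pos₂
  have h3 := h.three_nsmul_le
  have tpos : 0 < t := by
    clear * - hlow p p₂ h3
    grind
  obtain ⟨e, he⟩ : ∃ e : Γ, formDeg w (dWedge f g₂) = e := by
    have hne : formDeg w (dWedge f g₂) ≠ ⊥ := by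
      intro h0
      rw [h0] at hE
      exact WithBot.coe_ne_bot (le_bot_iff.1 hE)
    obtain ⟨e, he⟩ := WithBot.ne_bot_iff_exists.1 hne
    exact ⟨e, he.symm⟩
  have heu := formDeg_dWedge_le ht.le h.wdeg₂.le
  rw [he, WithBot.coe_le_coe] at hE hE' heu
  -- `C b * f` is a difference of two polynomials of degree `d₂`.
  have htb : b ≠ 0 → t ≤ d₂ := by
    intro hb
    have h1 : wdeg w (C b * f) ≤ (d₂ : WithBot Γ) := by
      rw [show C b * f = g₂' - g₂ by rw [hg₂]; ring]
      exact wdeg_sub_le h'.wdeg₂.le h.wdeg₂.le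
    rw [wdeg_mul, wdeg_C hb, zero_add, ht] at h1
    exact_mod_cast h1
  have hD := h.formDeg_eq
  -- If `a ≠ 0`, the term `(2af + c) df ∧ dg₂` of degree `t + e` dominates, so `D' = t + e`, while
  -- `e ≥ d₁' + D'`. When `b ≠ 0`, its competitor of degree `2 d₂ + D` loses because `t + e ≥ 2 d₁ -
  -- d₂ + 2 D = 2 d₂ + 2 D`.
  have ha : a = 0 := by
    by_contra ha
    have hq : wdeg w (C (2 * a) * f + C c) = t := by
      have h1 : wdeg w (C (2 * a) * f) = t := by
        rw [wdeg_mul, wdeg_C (mul_ne_zero two_ne_zero ha), zero_add, ht]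
      rw [wdeg_add_eq_left, h1]
      rw [h1]
      exact (wdeg_C_le c).trans_lt (by exact_mod_cast tpos)
    have hη : formDeg w ((C (2 * a) * f + C c) • dWedge f g₂) = (t + e : Γ) := by
      rw [formDeg_smul, hq, he, WithBot.coe_add]
    rw [formDeg_add_eq_right, hη, WithBot.coe_inj] at hω
    · clear * - hω hE' tpos p₁'
      grind
    rw [hη]
    by_cases hb : b = 0
    · rw [hb, map_zero, neg_zero, zero_smul, add_zero, hD, WithBot.coe_lt_coe]
      clear * - hE tpos p₁
      grind
    · have htd := htb hb
      obtain ⟨hd, hE₁⟩ := hsmall htd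
      obtain ⟨hd', -⟩ := hsmall' htd
      have h2t : 2 • t ≤ d₁ := by
        have hdd : d₁' = d₁ := by
          clear * - hd hd'
          grind
        have h1 : wdeg w (C a * f ^ 2 + C c * f) ≤ (d₁ : WithBot Γ) := by
          rw [show C a * f ^ 2 + C c * f = g₁' - g₁ by rw [hg₁]; ring]
          exact wdeg_sub_le (h'.wdeg₁.le.trans (by rw [hdd])) h.wdeg₁.le
        have h2 : wdeg w (C a * f ^ 2) = (2 • t : Γ) := by
          rw [wdeg_mul, wdeg_C ha, zero_add, wdeg_pow_coe ht]
        rw [wdeg_add_eq_left, h2] at h1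
        · exact_mod_cast h1
        · rw [h2, wdeg_mul, ht]
          refine (add_le_add_left (wdeg_C_le c) _).trans_lt ?_
          rw [zero_add, WithBot.coe_lt_coe]
          clear * - tpos
          grind
      refine (formDeg_add_le (α := ((2 • d₂ + D : Γ) : WithBot Γ)) ?_ ?_).trans_lt ?_
      · rw [hD, WithBot.coe_le_coe]
        clear * - p₂
        grind
      · rw [formDeg_smul, wdeg_neg, wdeg_C hb, zero_add, hE₁]
      · rw [WithBot.coe_lt_coe]
        clear * - hd hlow hE p
        grind
  subst ha
  rw [mul_zero, map_zero, zero_mul, zero_add] at hω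
  have hη : formDeg w ((C c : MvPolynomial (Fin n) k) • dWedge f g₂) ≤ (e : WithBot Γ) := by
    rw [formDeg_smul, he]
    exact (add_le_add_left (wdeg_C_le c) _).trans_eq (zero_add _)
  -- If `b ≠ 0`, the term in `df ∧ dg₁` dominates since `e ≤ t + d₂ ≤ 2 d₂`, giving `D' = 2 d₂ + D`.
  -- But `df ∧ dg₁` is the same form for both pairs, so its two degree formulas force `D = D'`.
  have hb : b = 0 := by
    by_contra hb
    have htd := htb hb
    obtain ⟨hd, hE₁⟩ := hsmall htd
    obtain ⟨hd', hE₁'⟩ := hsmall' htd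
    have h1 : formDeg w ((-C b : MvPolynomial (Fin n) k) • dWedge f g₁) = (2 • d₂ + D : Γ) := by
      rw [formDeg_smul, wdeg_neg, wdeg_C hb, zero_add, hE₁]
    rw [add_right_comm, formDeg_add_eq_right, h1, WithBot.coe_inj] at hω
    · rw [hE₁, WithBot.coe_inj] at hE₁'
      clear * - hE₁' hω p₂
      grind
    rw [h1]
    refine (formDeg_add_le (α := (e : WithBot Γ)) ?_ hη).trans_lt ?_
    · rw [hD, WithBot.coe_le_coe]
      clear * - hE p₁
      grind
    · rw [WithBot.coe_lt_coe]
      clear * - heu htd p p₂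
      grind
  subst hb
  refine ⟨rfl, rfl, ?_⟩
  -- Now `D' = e`, again contradicting `e ≥ d₁' + D'`.
  by_contra hc
  have h1 : formDeg w ((C c : MvPolynomial (Fin n) k) • dWedge f g₂) = e := by
    rw [formDeg_smul, he, wdeg_C hc, zero_add]
  rw [map_zero, neg_zero, zero_smul, add_zero, formDeg_add_eq_right, h1, WithBot.coe_inj] at hω
  · clear * - hω hE' p₁'
    grind
  · rw [hD, h1, WithBot.coe_lt_coe]
    clear * - hE p₁
    grind

end Uniqueness

end ShestakovUmirbaev

/-! ### The proposition. -/

theorem proposition8p2 {k : Type*} [Field k] [CharZero k]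
    {Γ : Type*} [AddCommGroup Γ] [LinearOrder Γ] [IsOrderedAddMonoid Γ] [Module.Finite ℤ Γ]
    {n : ℕ} (hn : 3 ≤ n) (w : Fin n → Γ) (hw : ∀ i, 0 < w i)
    (F G₁ G₂ : Fin 3 → MvPolynomial (Fin n) k)
    (hF : F ∈ ShestakovUmirbaev.Triples k n)
    (hG₁ : G₁ ∈ ShestakovUmirbaev.Triples k n)
    (hG₂ : G₂ ∈ ShestakovUmirbaev.Triples k n)
    (h₁ : ShestakovUmirbaev.SUCondition w F G₁)
    (h₂ : ShestakovUmirbaev.SUCondition w F G₂) :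
    G₁ 0 = G₂ 0 ∧ G₁ 1 = G₂ 1 ∧ G₁ 2 - G₂ 2 ∈ Algebra.adjoin k {G₁ 1} := by
  open ShestakovUmirbaev in
  obtain ⟨d₁, d₂, D, s, hp, hlt⟩ := h₁.exists_pairData hw
  obtain ⟨d₁', d₂', D', s', hp', hlt'⟩ := h₂.exists_pairData hw
  obtain rfl : d₂ = d₂' := by
    have := h₁.su2.2.symm.trans h₂.su2.2
    rw [hp.wdeg₂, hp'.wdeg₂] at this
    exact_mod_cast this
  obtain ⟨t, ht, htd, hlow, hE, hsmall⟩ := h₁.estimates hp hlt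
  obtain ⟨t', ht', -, -, hE', hsmall'⟩ := h₂.estimates hp' hlt'
  obtain rfl : t = t' := by
    rw [ht] at ht'
    exact_mod_cast ht'
  obtain ⟨⟨a, b, c, ha, hb⟩, hm⟩ := h₁.su1
  obtain ⟨⟨a', b', c', ha', hb'⟩, hm'⟩ := h₂.su1
  have hg₁ : G₂ 0 = G₁ 0 + C (a' - a) * F 2 ^ 2 + C (c' - c) * F 2 := by
    rw [ha, ha', C_sub, C_sub]
    ring
  have hg₂ : G₂ 1 = G₁ 1 + C (b' - b) * F 2 := by
    rw [hb, hb', C_sub]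
    ring
  obtain ⟨h0, h0', h0''⟩ := perturb_eq_zero hp hp' hg₁ hg₂ ht hlow hE hE' hsmall hsmall'
  have e₁ : G₁ 0 = G₂ 0 := by rw [hg₁, h0, h0'']; simp
  have e₂ : G₁ 1 = G₂ 1 := by rw [hg₂, h0']; simp
  refine ⟨e₁, e₂, ?_⟩
  have hd : d₁' = d₁ := by
    have := hp'.wdeg₁
    rw [← e₁, hp.wdeg₁] at this
    exact_mod_cast this.symm
  have hD : D' = D := by
    have := hp'.formDeg_eq
    rw [← e₁, ← e₂, hp.formDeg_eq] at this
    exact_mod_cast this.symm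
  subst hd hD
  -- Both third entries are congruent to `F 2` modulo the common algebra `k[g₁, g₂]`; (SU4) with
  -- (SU5), and (SU6), supply the two degree bounds.
  apply hp.mem_adjoin_singleton
  · rw [← sub_sub_sub_cancel_right (G₁ 2) (G₂ 2) (F 2)]
    refine Subalgebra.sub_mem _ hm ?_
    rw [e₁, e₂]
    exact hm'
  · have hf : wdeg w (F 2) ≤ (d₁' : WithBot Γ) := by
      rw [ht]
      exact_mod_cast htd
    have := max_lt (h₁.su5.trans_le hf) (h₂.su5.trans_le hf)
    exact (wdeg_sub_le (le_max_left (wdeg w (G₁ 2)) (wdeg w (G₂ 2)))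
      (le_max_right (wdeg w (G₁ 2)) (wdeg w (G₂ 2)))).trans_lt this
  · exact (wdeg_sub_le (le_max_left (wdeg w (G₁ 2)) (wdeg w (G₂ 2)))
      (le_max_right (wdeg w (G₁ 2)) (wdeg w (G₂ 2)))).trans_lt (max_lt hlt hlt')
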